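/- Let $M$ buildings share a bidding horizon $N$. For each building $b$ let $c_b\in\mathbb R^{Nm_b}$ be a cost vector and let $\mathcal C_b$ be a set of pairs $(u_b(\cdot),y_b)$ of an input policy $u_b(\cdot):\mathbb R^N\to\mathbb R^{Nm_b}$ and a reserve bid $y_b\in\mathbb R^N$; let $p\in\mathbb R^N$ be a price vector. The aggregated bidding problem is $$\min_{Y,\{u_b(\cdot),y_b\}_b}\ \sum_{b=1}^M c_b^\top u_b(0)-p^\top Y\quad\text{s.t. } (u_b(\cdot),y_b)\in\mathcal C_b\ \ \forall b,\quad Y=\sum_{b=1}^M y_b,\quad Y^1=\dots=Y^N .$$ For $\rho>0$ and any initial $\{\bar y_b,\lambda_b\}_b$ in $\mathbb R^N$, the algorithm repeats: 1. for every $b$: $(u_b(\cdot),y_b)\leftarrow\arg\min\{c_b^\top u_b(0)-\lambda_b^\top y_b+\tfrac\rho2\|\bar y_b-y_b\|_2^2 : (u_b(\cdot),y_b)\in\mathcal C_b\}$ (any minimizer); 2. $(Y,\{\bar y_b\}_b)\leftarrow\arg\min\{\sum_{b}(\lambda_b^\top\bar y_b+\tfrac\rho2\|\bar y_b-y_b\|_2^2)-p^\top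 Y : Y=\sum_b\bar y_b,\ Y^1=\dots=Y^N\}$; 3. for every $b$: $\lambda_b\leftarrow\lambda_b+\rho(\bar y_b-y_b)$. Suppose that each $\mathcal C_b$ is nonempty, convex, closed, and contained in a finite-dimensional space, and that the Lagrangian $\sum_b c_b^\top u_b(0)-p^\top Y+\sum_b\lambda_b^\top(\bar y_b-y_b)$, with primal domain $(u_b(\cdot),y_b)\in\mathcal C_b$ for all $b$, $Y=\sum_b\bar y_b$, $Y^1=\dots=Y^N$, has a saddle point (so that, in particular, the aggregated bidding problem has an optimal solution). Then for every sequence of iterates generated by the algorithm there are limits $Y$, $\{y_b\}_b$, $\{\lambda_b\}_b$ such that: - $Y^{(k)}\to Y$, $y_b^{(k)}\to y_b$, $\bar y_b^{(k)}\to y_b$, $\lambda_b^{(k)}\to\lambda_b$ for all $b$, where $Y=\sum_b y_b$ and $Y$ is constant in time; - the objective $\sum_b c_b^\top u_b^{(k)}(0)-p^\top Y^{(k)}$ converges to the optimal value of the aggregated bidding problem, which is attained; - $\{\lambda_b\}_b$ is an optimal multiplier: together with any optimal solution it forms a saddle point; - for every accumulation point $\{u_b(\cdot)\}_b$ of the policies,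 $(Y,\{u_b(\cdot),y_b\}_b)$ is an optimal solution of the aggregated bidding problem; - if the policy iterates are bounded, then the iterates converge to the set of optimal solutions: there are optimal solutions $(Y,\{u_b^{*(k)}(\cdot),y_b\}_b)$ with $u_b^{(k)}(\cdot)-u_b^{*(k)}(\cdot)\to0$ for all $b$. If moreover, for every $b$, the set $\{(y_b,t): \exists\,u_b(\cdot),\ (u_b(\cdot),y_b)\in\mathcal C_b,\ c_b^\top u_b(0)\le t\}$ is closed (as is the case when $\mathcal C_b$ is compact or a polyhedron), then the algorithm can be carried out from every initialization, and the limits of the bids always belong to an optimal solution: there is $\{u_b(\cdot)\}_b$ such that $(Y,\{u_b(\cdot),y_b\}_b)$ is optimal. -/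

import Mathlib

open Filter Topology

/-- Reserve bids over the horizon `1, …, N`, with the Euclidean inner product and norm. The same
space holds the reserve requests `s`, the prices `p` and the multipliers of one building. -/
abbrev Bid (N : ℕ) : Type := EuclideanSpace ℝ (Fin N)

/-- Stacked input trajectories in `ℝ^(N m)`; the index `(k, i)` is input `i` at time `k`. -/
abbrev Input (N m : ℕ) : Type := EuclideanSpace ℝ (Fin N × Fin m)

/-- Closed-loop input policies `u(·) : s ↦ u(s)`, with pointwise operations and the topology of
pointwise convergence. On each finite-dimensional subspace this is the usual (unique Hausdorff
vector space) topology. -/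
abbrev Policy (N m : ℕ) : Type := Bid N → Input N m

/-- `Y¹ = Y² = ⋯ = Yᴺ`. -/
def IsTimeConstant {N : ℕ} (Y : Bid N) : Prop := ∀ j k, Y j = Y k

/-- The data of an aggregation of `M` buildings with a common horizon `N`. -/
structure Aggregation (N M : ℕ) where
  /-- number of inputs of each building -/
  m : Fin M → ℕ
  /-- electricity cost vector of each building -/
  c : (b : Fin M) → Input N (m b)
  /-- reserve price -/
  p : Bid N
  /-- constraint set of each building: the admissible pairs of a policy and a reserve bid -/
  C : (b : Fin M) → Set (Policy N (m b) × Bid N)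

namespace Aggregation

variable {N M : ℕ} (P : Aggregation N M)

/-- The tuples `{u_b(·)}_b` of input policies. -/
abbrev Policies : Type := (b : Fin M) → Policy N (P.m b)

/-! ### The aggregated bidding problem -/

/-- `∑_b c_bᵀ u_b(0) - pᵀ Y`. -/
noncomputable def cost (u : P.Policies) (Y : Bid N) : ℝ :=
  ∑ b, inner ℝ (P.c b) (u b 0) - inner ℝ P.p Y

/-- The constraints of the aggregated bidding problem. -/
def IsFeasible (Y : Bid N) (u : P.Policies) (y : Fin M → Bid N) : Prop :=
  (∀ b, (u b, y b) ∈ P.C b) ∧ Y = ∑ b, y b ∧ IsTimeConstant Y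

/-- Optimal solutions of the aggregated bidding problem. -/
def IsOptimal (Y : Bid N) (u : P.Policies) (y : Fin M → Bid N) : Prop :=
  P.IsFeasible Y u y ∧
    ∀ (Y' : Bid N) (u' : P.Policies) (y' : Fin M → Bid N),
      P.IsFeasible Y' u' y' → P.cost u Y ≤ P.cost u' Y'

/-! ### The algorithm -/

/-- The variables of the algorithm. -/
structure State where
  /-- input policies `u_b(·)` -/
  u : P.Policies
  /-- proposed bids `y_b` -/
  y : Fin M → Bid N
  /-- aggregated bid `Y` -/
  Y : Bid N
  /-- demanded bids `ȳ_b` -/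
  ybar : Fin M → Bid N
  /-- Lagrange multipliers `λ_b` -/
  lam : Fin M → Bid N

/-- Objective of the building-individual step of building `b`, as a function of `(u_b(·), y_b)`. -/
noncomputable def buildingObjective (ρ : ℝ) (b : Fin M) (lam ybar : Bid N)
    (x : Policy N (P.m b) × Bid N) : ℝ :=
  inner ℝ (P.c b) (x.1 0) - inner ℝ lam x.2 + ρ / 2 * ‖ybar - x.2‖ ^ 2

/-- Objective of the aggregation step, as a function of `(Y, {ȳ_b}_b)`. -/
noncomputable def aggregationObjective (ρ : ℝ) (lam y : Fin M → Bid N)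
    (w : Bid N × (Fin M → Bid N)) : ℝ :=
  ∑ b, (inner ℝ (lam b) (w.2 b) + ρ / 2 * ‖w.2 b - y b‖ ^ 2) - inner ℝ P.p w.1

/-- The pairs `(Y, {ȳ_b}_b)` with `Y = ∑_b ȳ_b` and `Y¹ = ⋯ = Yᴺ`. -/
def aggregationSet (N M : ℕ) : Set (Bid N × (Fin M → Bid N)) :=
  {w | w.1 = ∑ b, w.2 b ∧ IsTimeConstant w.1}

/-- One iteration, from `σ` to `σ'`: the building-individual steps, the aggregation step, and the
multiplier update. Where a building has several minimizers, any of them may be chosen. -/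
def IsStep (ρ : ℝ) (σ σ' : P.State) : Prop :=
  (∀ b, (σ'.u b, σ'.y b) ∈ P.C b ∧
    IsMinOn (P.buildingObjective ρ b (σ.lam b) (σ.ybar b)) (P.C b) (σ'.u b, σ'.y b)) ∧
  ((σ'.Y, σ'.ybar) ∈ aggregationSet N M ∧
    IsMinOn (P.aggregationObjective ρ σ.lam σ'.y) (aggregationSet N M) (σ'.Y, σ'.ybar)) ∧
  ∀ b, σ'.lam b = σ.lam b + ρ • (σ'.ybar b - σ'.y b)

/-- Sequences generated by the algorithm with penalty `ρ`. The state `it 0` is an arbitrary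
initialization, of which only `ȳ` and `λ` are used. -/
def IsRun (ρ : ℝ) (it : ℕ → P.State) : Prop := ∀ k, P.IsStep ρ (it k) (it (k + 1))

/-! ### Lagrangian and value functions -/

/-- The (unaugmented) Lagrangian of the aggregated problem split by the constraints `ȳ_b = y_b`,
`∑_b c_bᵀ u_b(0) - pᵀ Y + ∑_b λ_bᵀ (ȳ_b - y_b)`. -/
noncomputable def lagrangian (σ : P.State) : ℝ :=
  P.cost σ.u σ.Y + ∑ b, inner ℝ (σ.lam b) (σ.ybar b - σ.y b)

/-- The domain of the Lagrangian: all constraints except `ȳ_b = y_b`. -/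
def IsAdmissible (σ : P.State) : Prop :=
  (∀ b, (σ.u b, σ.y b) ∈ P.C b) ∧ (σ.Y, σ.ybar) ∈ aggregationSet N M

/-- `σ` is a saddle point of the Lagrangian: minimal in the primal variables over its domain,
maximal in the multipliers. -/
def IsSaddlePoint (σ : P.State) : Prop :=
  P.IsAdmissible σ ∧
  (∀ lam' : Fin M → Bid N, P.lagrangian { σ with lam := lam' } ≤ P.lagrangian σ) ∧
  ∀ σ' : P.State, P.IsAdmissible σ' → σ'.lam = σ.lam → P.lagrangian σ ≤ P.lagrangian σ'

/-- The pairs `(y_b, t)` such that building `b` can offer `y_b` at a nominal cost of at most `t`.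
It is closed for instance if `C_b` is compact or a polyhedron. -/
def costEpigraph (b : Fin M) : Set (Bid N × ℝ) :=
  {q | ∃ u : Policy N (P.m b), (u, q.1) ∈ P.C b ∧ inner ℝ (P.c b) (u 0) ≤ q.2}

end Aggregation

/-! A policy enters the problem only through its nominal cost, so each building is replaced by its
cost epigraph in `Bid N × ℝ`, and the algorithm becomes ADMM for `y = z`, with `z` in the subspace
`balanced`. By convexity, minimality in a building step says that an affine function with slope `lam
+ ρ • (z - y)` supports the epigraph; the aggregation step and the update say that the new
multipliers minus `p` are orthogonal to `balanced`.

Testing these conditions against a saddle point gives Fejér monotonicity (`admmPotential_add_le`):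
the potential drops by at least the potential between successive iterates. Hence the iterates are
bounded, increments and residuals vanish, and a subsequence converges to a saddle point
(`exists_subseq_tendsto_saddle`). Measured from that point, the potential is antitone and tends to
zero along a subsequence, hence along the whole sequence.

Epigraphs need not be closed, so limits of costs are only known to lie in closures. Saddle points
are defined accordingly; this does not change the optimal value (`IsOptimal.cost_eq`). Policies
return only at cluster points, by closedness of `C b`. -/

/-! ### First-order conditions, approximation of cluster sets, existence of minimizers -/

section General

/-- The first order condition for a quadratic function of `ε` to be minimal at `0` on `[0, 1]`. -/
theorem nonneg_of_forall_mul_add_sq_mul_nonneg {a c : ℝ}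
    (h : ∀ ε : ℝ, 0 < ε → ε ≤ 1 → 0 ≤ ε * a + ε ^ 2 * c) : 0 ≤ a := by
  by_contra! ha
  -- This choice gives `ε * |c| ≤ -a / 2`, so the quadratic term cannot compensate `a < 0`.
  set ε : ℝ := min 1 (-a / (2 * (1 + |c|))) with hε
  have hε0 : 0 < ε := lt_min one_pos (div_pos (by linarith) (by positivity))
  have h1 := h ε hε0 (min_le_left _ _)
  have h2 : ε * (2 * (1 + |c|)) ≤ -a :=
    (le_div_iff₀ (by positivity)).1 (min_le_right _ _)
  have h3 : 0 ≤ a + ε * c := by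
    by_contra! h4
    nlinarith
  have h5 : ε * c ≤ ε * |c| := mul_le_mul_of_nonneg_left (le_abs_self c) hε0.le
  nlinarith [abs_nonneg c]

theorem le_of_sum_le_sum_of_mem {ι : Type*} [Fintype ι] {α : ι → Type*}
    {A : ∀ i, Set (α i)} {f : ∀ i, α i → ℝ} {x : ∀ i, α i} (hx : ∀ i, x i ∈ A i)
    (h : ∀ x' : ∀ i, α i, (∀ i, x' i ∈ A i) → ∑ i, f i (x i) ≤ ∑ i, f i (x' i))
    (i : ι) {v : α i} (hv : v ∈ A i) : f i (x i) ≤ f i v := by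
  classical
  have h1 := h (Function.update x i v) fun j => by
    rcases eq_or_ne j i with rfl | hj
    · simpa using hv
    · simpa [hj] using hx j
  rw [Fintype.sum_eq_add_sum_compl i, Fintype.sum_eq_add_sum_compl i] at h1
  have h2 : ∑ j ∈ {i}ᶜ, f j (Function.update x i v j) = ∑ j ∈ {i}ᶜ, f j (x j) :=
    Finset.sum_congr rfl fun j hj => by
      rw [Function.update_of_ne (by simpa using hj)]
  rw [h2] at h1
  simpa using h1

/-- A sequence in a compact subset of a finite-dimensional subspace approaches every set that
contains all its cluster points. -/
theorem exists_seq_mem_tendsto_sub_zero {E : Type*} [AddCommGroup E] [Module ℝ E]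
    [TopologicalSpace E] [IsTopologicalAddGroup E] [ContinuousSMul ℝ E] [T2Space E]
    (V : Submodule ℝ E) [FiniteDimensional ℝ V] {K S : Set E} (hK : IsCompact K) {x : ℕ → E}
    (hxV : ∀ k, x k ∈ V) (hxK : ∀ k, x k ∈ K)
    (hS : ∀ a, MapClusterPt a atTop x → a ∈ S) :
    ∃ s : ℕ → E, (∀ k, s k ∈ S) ∧ Tendsto (fun k => x k - s k) atTop (𝓝 0) := by
  classical
  have hVc : IsClosed (V : Set E) := V.closed_of_finiteDimensional
  -- `E` carries no metric; distances are measured after transporting `V` to a Euclidean space.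
  let e : V ≃L[ℝ] EuclideanSpace ℝ (Fin (Module.finrank ℝ V)) :=
    ContinuousLinearEquiv.ofFinrankEq (by simp)
  have hKV : IsCompact (((↑) : V → E) ⁻¹' K) :=
    hVc.isClosedEmbedding_subtypeVal.isCompact_preimage hK
  have hK' : IsCompact (e '' (((↑) : V → E) ⁻¹' K)) := hKV.image e.continuous
  let a : ℕ → EuclideanSpace ℝ (Fin (Module.finrank ℝ V)) := fun k => e ⟨x k, hxV k⟩
  let S' : Set (EuclideanSpace ℝ (Fin (Module.finrank ℝ V))) := {z | (e.symm z : E) ∈ S}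
  have haK : ∀ k, a k ∈ e '' (((↑) : V → E) ⁻¹' K) := fun k => ⟨⟨x k, hxV k⟩, hxK k, rfl⟩
  have key : ∀ ns : ℕ → ℕ, Tendsto ns atTop atTop → ∃ z ∈ S', ∃ ms : ℕ → ℕ,
      Tendsto (fun n => a (ns (ms n))) atTop (𝓝 z) := by
    intro ns hns
    obtain ⟨z, -, ms, hms, hz⟩ := hK'.tendsto_subseq fun n => haK (ns n)
    refine ⟨z, hS _ ?_, ms, hz⟩
    have h1 : Tendsto (fun n => ((e.symm (a (ns (ms n))) : V) : E)) atTop (𝓝 (e.symm z : E)) :=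
      ((continuous_subtype_val.comp e.symm.continuous).tendsto z).comp hz
    have h2 : Tendsto (x ∘ fun n => ns (ms n)) atTop (𝓝 (e.symm z : E)) := by
      refine h1.congr fun n => ?_
      simp [a]
    exact h2.mapClusterPt.of_comp (hns.comp hms.tendsto_atTop)
  have hne : S'.Nonempty := by
    obtain ⟨z, hz, -⟩ := key id tendsto_id
    exact ⟨z, hz⟩
  have hd : Tendsto (fun k => Metric.infDist (a k) S') atTop (𝓝 0) := by
    refine tendsto_of_subseq_tendsto fun ns hns => ?_
    obtain ⟨z, hz, ms, hms⟩ := key ns hns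
    refine ⟨ms, ?_⟩
    have := ((Metric.continuous_infDist_pt S').tendsto z).comp hms
    rwa [Metric.infDist_zero_of_mem hz] at this
  -- `S'` is not assumed closed, so near-minimizers of the distance replace nearest points.
  have hch : ∀ k, ∃ z ∈ S', dist (a k) z < Metric.infDist (a k) S' + 1 / ((k : ℝ) + 1) := fun k =>
    (Metric.infDist_lt_iff hne).1 (lt_add_of_pos_right _ (by positivity))
  choose z hz hzd using hch
  have hlim : Tendsto (fun k => a k - z k) atTop (𝓝 0) := by
    rw [tendsto_zero_iff_norm_tendsto_zero]
    refine squeeze_zero (fun _ => norm_nonneg _) (fun k => ?_)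
      (by simpa only [add_zero] using hd.add tendsto_one_div_add_atTop_nhds_zero_nat)
    rw [← dist_eq_norm]
    exact (hzd k).le
  refine ⟨fun k => (e.symm (z k) : E), hz, ?_⟩
  have h := ((continuous_subtype_val.comp e.symm.continuous).tendsto 0).comp hlim
  refine Tendsto.congr (fun k => ?_) (by simpa using h)
  simp [a]

/-- An augmented objective attains its minimum on a closed epigraph with an affine minorant. -/
theorem exists_isMinOn_augmented {X : Type*} [NormedAddCommGroup X] [InnerProductSpace ℝ X]
    [FiniteDimensional ℝ X] {E : Set (X × ℝ)} (hE : IsClosed E) (hne : E.Nonempty)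
    {lam' : X} {γ : ℝ} (hminor : ∀ q ∈ E, γ + inner ℝ lam' q.1 ≤ q.2)
    {ρ : ℝ} (hρ : 0 < ρ) (lam z : X) :
    ∃ q ∈ E, IsMinOn (fun q : X × ℝ => q.2 - inner ℝ lam q.1 + ρ / 2 * ‖z - q.1‖ ^ 2) E q := by
  obtain ⟨q₀, hq₀⟩ := hne
  set φ : X × ℝ → ℝ := fun q => q.2 - inner ℝ lam q.1 + ρ / 2 * ‖z - q.1‖ ^ 2 with hφ
  have hφc : Continuous φ := by fun_prop
  set A : ℝ := ‖lam' - lam‖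
  set B : ℝ := |φ q₀ - γ - inner ℝ (lam' - lam) z|
  -- On the sublevel set of `q₀`, `v = ‖z - q.1‖` satisfies `ρ / 2 * v ^ 2 - A * v ≤ B`, which fails
  -- for `v > R ≥ 1`.
  set R : ℝ := (2 * A + 2 * B) / ρ + 1 with hR
  have hv : ∀ q ∈ E, φ q ≤ φ q₀ → ‖z - q.1‖ ≤ R := by
    intro q hq hle
    have h1 := hminor q hq
    have h2 : inner ℝ (lam' - lam) (z - q.1) ≤ A * ‖z - q.1‖ := real_inner_le_norm _ _
    have h3 : φ q₀ - γ - inner ℝ (lam' - lam) z ≤ B := le_abs_self _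
    have h4 : inner ℝ lam' q.1 - inner ℝ lam q.1
        = inner ℝ (lam' - lam) z - inner ℝ (lam' - lam) (z - q.1) := by
      simp only [inner_sub_left, inner_sub_right]; ring
    have h5 : ρ / 2 * ‖z - q.1‖ ^ 2 - A * ‖z - q.1‖ ≤ B := by
      simp only [hφ] at hle h3 ⊢; linarith
    by_contra! hlt
    have hA : 0 ≤ A := norm_nonneg _
    have hB : 0 ≤ B := abs_nonneg _
    have h6 : 1 ≤ ‖z - q.1‖ :=
      le_trans (by rw [hR]; exact le_add_of_nonneg_left (by positivity)) hlt.le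
    have h7 : 2 * A + 2 * B + ρ < ρ * ‖z - q.1‖ := by
      have : ρ * R = 2 * A + 2 * B + ρ := by rw [hR]; field_simp
      rw [← this]; exact mul_lt_mul_of_pos_left hlt hρ
    nlinarith
  have hcomp : IsCompact {q | q ∈ E ∧ φ q ≤ φ q₀} := by
    refine Metric.isCompact_of_isClosed_isBounded
      (hE.inter (isClosed_le hφc continuous_const)) ?_
    refine ((Metric.isBounded_closedBall (x := z) (r := R)).prod
      (Metric.isBounded_Icc (γ - ‖lam'‖ * (‖z‖ + R)) (φ q₀ + ‖lam‖ * (‖z‖ + R)))).subset ?_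
    rintro q ⟨hq, hle⟩
    have hb := hv q hq hle
    have hb' : ‖q.1‖ ≤ ‖z‖ + R := by
      have := norm_sub_le z (z - q.1)
      rw [sub_sub_cancel] at this
      linarith
    refine ⟨by rwa [Metric.mem_closedBall, dist_comm, dist_eq_norm], ?_, ?_⟩
    · have h1 := hminor q hq
      have h2 := (abs_le.1 (abs_real_inner_le_norm lam' q.1)).1
      have h3 := mul_le_mul_of_nonneg_left hb' (norm_nonneg lam')
      linarith
    · have h2 := real_inner_le_norm lam q.1
      have h3 := mul_le_mul_of_nonneg_left hb' (norm_nonneg lam)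
      have h4 : 0 ≤ ρ / 2 * ‖z - q.1‖ ^ 2 := by positivity
      have h5 : q.2 - inner ℝ lam q.1 + ρ / 2 * ‖z - q.1‖ ^ 2 ≤ φ q₀ := hle
      linarith
  obtain ⟨q, hq, hmin⟩ := hcomp.exists_isMinOn ⟨q₀, hq₀, le_rfl⟩ hφc.continuousOn
  refine ⟨q, hq.1, fun r hr => ?_⟩
  rcases le_total (φ r) (φ q₀) with h | h
  · exact hmin ⟨hr, h⟩
  · exact hq.2.trans h

end General

/-! ### The Lyapunov function -/

section Potential

variable {ι X : Type*} [Fintype ι] [NormedAddCommGroup X] {ρ : ℝ}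

/-- The Lyapunov function of the method. -/
noncomputable def admmPotential (ρ : ℝ) (z lam z' lam' : ι → X) : ℝ :=
  ∑ i, (‖lam i - lam' i‖ ^ 2 / ρ + ρ * ‖z i - z' i‖ ^ 2)

theorem admmPotential_nonneg (hρ : 0 < ρ) (z lam z' lam' : ι → X) :
    0 ≤ admmPotential ρ z lam z' lam' :=
  Finset.sum_nonneg fun _ _ => by positivity

theorem norm_sub_le_of_admmPotential_le (hρ : 0 < ρ) {z lam z' lam' : ι → X} {c : ℝ}
    (h : admmPotential ρ z lam z' lam' ≤ c) (i : ι) :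
    ‖lam i - lam' i‖ ^ 2 ≤ ρ * c ∧ ‖z i - z' i‖ ^ 2 ≤ c / ρ := by
  have h1 : ‖lam i - lam' i‖ ^ 2 / ρ + ρ * ‖z i - z' i‖ ^ 2 ≤ c :=
    (Finset.single_le_sum (f := fun i => ‖lam i - lam' i‖ ^ 2 / ρ + ρ * ‖z i - z' i‖ ^ 2)
      (fun _ _ => by positivity) (Finset.mem_univ i)).trans h
  have h2 : 0 ≤ ‖lam i - lam' i‖ ^ 2 / ρ := by positivity
  have h3 : 0 ≤ ρ * ‖z i - z' i‖ ^ 2 := by positivity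
  constructor
  · have : ‖lam i - lam' i‖ ^ 2 / ρ ≤ c := by linarith
    rwa [div_le_iff₀ hρ, mul_comm] at this
  · rw [le_div_iff₀ hρ]; linarith

/-- The reference pair may vary with `k`, which allows both a fixed saddle point and the preceding
iterate. -/
theorem tendsto_of_admmPotential {l : Filter ℕ} (hρ : 0 < ρ) {z lam z' lam' : ℕ → ι → X}
    (h : Tendsto (fun k => admmPotential ρ (z k) (lam k) (z' k) (lam' k)) l (𝓝 0)) (i : ι) :
    Tendsto (fun k => lam k i - lam' k i) l (𝓝 0) ∧ Tendsto (fun k => z k i - z' k i) l (𝓝 0) := by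
  constructor <;> rw [tendsto_zero_iff_norm_tendsto_zero]
  · have h1 : Tendsto (fun k => ‖lam k i - lam' k i‖ ^ 2) l (𝓝 0) :=
      squeeze_zero (fun _ => by positivity)
        (fun k => (norm_sub_le_of_admmPotential_le hρ le_rfl i).1)
        (by simpa using h.const_mul ρ)
    simpa [Real.sqrt_sq] using h1.sqrt
  · have h1 : Tendsto (fun k => ‖z k i - z' k i‖ ^ 2) l (𝓝 0) :=
      squeeze_zero (fun _ => by positivity)
        (fun k => (norm_sub_le_of_admmPotential_le hρ le_rfl i).2)
        (by simpa using h.div_const ρ)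
    simpa [Real.sqrt_sq] using h1.sqrt

end Potential

/-! ### Convergence of ADMM on epigraphs -/

section ADMM

variable {ι X : Type*} [Fintype ι] [NormedAddCommGroup X] [InnerProductSpace ℝ X]

/-- Saddle points of the split problem of minimizing `∑ t i - ∑ ⟪q i, y i⟫` over
`(y i, t i) ∈ closure (E i)` and `y ∈ L`. -/
structure IsEpigraphSaddle (E : ι → Set (X × ℝ)) (L : Submodule ℝ (ι → X)) (q : ι → X)
    (y : ι → X) (t : ι → ℝ) (lam : ι → X) : Prop where
  mem : y ∈ L
  orth : ∀ w ∈ L, ∑ i, inner ℝ (lam i - q i) (w i) = 0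
  mem_closure : ∀ i, (y i, t i) ∈ closure (E i)
  le : ∀ i, ∀ r ∈ E i, t i + inner ℝ (lam i) (r.1 - y i) ≤ r.2

/-- Sequences generated by the alternating direction method of multipliers, described by the
first order conditions of the two minimizations. -/
structure IsADMMRun (E : ι → Set (X × ℝ)) (L : Submodule ℝ (ι → X)) (q : ι → X) (ρ : ℝ)
    (y z lam : ℕ → ι → X) (t : ℕ → ι → ℝ) : Prop where
  mem_epigraph : ∀ k i, (y (k + 1) i, t (k + 1) i) ∈ E i
  le : ∀ k i, ∀ r ∈ E i, t (k + 1) i +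
    inner ℝ (lam k i + ρ • (z k i - y (k + 1) i)) (r.1 - y (k + 1) i) ≤ r.2
  mem : ∀ k, z (k + 1) ∈ L
  orth : ∀ k, ∀ w ∈ L, ∑ i, inner ℝ (lam (k + 1) i - q i) (w i) = 0
  update : ∀ k i, lam (k + 1) i = lam k i + ρ • (z (k + 1) i - y (k + 1) i)

variable {E : ι → Set (X × ℝ)} {L : Submodule ℝ (ι → X)} {q : ι → X} {ρ : ℝ}

theorem IsEpigraphSaddle.le_of_mem_closure {y lam : ι → X} {t : ι → ℝ}
    (h : IsEpigraphSaddle E L q y t lam) (i : ι) {r : X × ℝ} (hr : r ∈ closure (E i)) :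
    t i + inner ℝ (lam i) (r.1 - y i) ≤ r.2 :=
  (isClosed_le (f := fun r : X × ℝ => t i + inner ℝ (lam i) (r.1 - y i)) (by fun_prop)
    continuous_snd).closure_subset_iff.2 (h.le i) hr

/-- A saddle point minimizes `∑ (t i - ⟪q i, y i⟫)`. -/
theorem IsEpigraphSaddle.sum_le {y lam : ι → X} {t : ι → ℝ} (h : IsEpigraphSaddle E L q y t lam)
    {y' : ι → X} {t' : ι → ℝ} (hy' : y' ∈ L) (ht' : ∀ i, (y' i, t' i) ∈ closure (E i)) :
    ∑ i, (t i - inner ℝ (q i) (y i)) ≤ ∑ i, (t' i - inner ℝ (q i) (y' i)) := by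
  have h1 := Finset.sum_le_sum fun i (_ : i ∈ Finset.univ) => h.le_of_mem_closure i (ht' i)
  -- As `y' - y` lies in `L`, the slopes `lam i` act on it like `q i`.
  have h2 := h.orth _ (L.sub_mem hy' h.mem)
  simp only [inner_sub_left, inner_sub_right, Finset.sum_add_distrib, Finset.sum_sub_distrib,
    Pi.sub_apply] at h1 h2 ⊢
  linarith

/-- The point of a finite-dimensional subspace of a product that is nearest to `a`. -/
theorem exists_mem_forall_sum_inner_sub_eq_zero [FiniteDimensional ℝ X]
    (L : Submodule ℝ (ι → X)) (a : ι → X) :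
    ∃ z ∈ L, ∀ w ∈ L, ∑ i, inner ℝ (z i - a i) (w i) = 0 := by
  -- The plain product has the supremum norm; orthogonal projection needs its `ℓ²` version.
  let e : PiLp 2 (fun _ : ι => X) ≃ₗ[ℝ] (ι → X) := WithLp.linearEquiv 2 ℝ (ι → X)
  let L' : Submodule ℝ (PiLp 2 (fun _ : ι => X)) := L.comap e.toLinearMap
  let z : PiLp 2 (fun _ : ι => X) := L'.starProjection (e.symm a)
  refine ⟨e z, L'.starProjection_apply_mem (e.symm a), fun w hw => ?_⟩
  have h := Submodule.inner_right_of_mem_orthogonal (K := L') (u := e.symm w)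
    (v := e.symm a - z) (by simpa [L'] using hw) (L'.sub_starProjection_mem_orthogonal _)
  rw [PiLp.inner_apply] at h
  rw [← neg_eq_zero, ← Finset.sum_neg_distrib, ← h]
  refine Finset.sum_congr rfl fun i _ => ?_
  rw [← inner_neg_left, neg_sub, real_inner_comm]
  rfl

namespace IsADMMRun

variable {y z lam : ℕ → ι → X} {t : ℕ → ι → ℝ}

theorem le_of_mem_closure (h : IsADMMRun E L q ρ y z lam t) (k : ℕ) (i : ι) {r : X × ℝ}
    (hr : r ∈ closure (E i)) : t (k + 1) i +
      inner ℝ (lam k i + ρ • (z k i - y (k + 1) i)) (r.1 - y (k + 1) i) ≤ r.2 :=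
  (isClosed_le (f := fun r : X × ℝ => t (k + 1) i +
    inner ℝ (lam k i + ρ • (z k i - y (k + 1) i)) (r.1 - y (k + 1) i)) (by fun_prop)
    continuous_snd).closure_subset_iff.2 (h.le k i) hr

/-- Fejér monotonicity with respect to saddle points. -/
theorem admmPotential_add_le (h : IsADMMRun E L q ρ y z lam t) (hρ : 0 < ρ)
    {y' lam' : ι → X} {t' : ι → ℝ} (hs : IsEpigraphSaddle E L q y' t' lam') (k : ℕ) :
    admmPotential ρ (z (k + 2)) (lam (k + 2)) y' lam' +
      admmPotential ρ (z (k + 2)) (lam (k + 2)) (z (k + 1)) (lam (k + 1)) ≤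
    admmPotential ρ (z (k + 1)) (lam (k + 1)) y' lam' := by
  have hy : ∀ i, y (k + 2) i = z (k + 2) i - ρ⁻¹ • (lam (k + 2) i - lam (k + 1) i) := fun i => by
    rw [h.update (k + 1) i, add_sub_cancel_left, smul_smul, inv_mul_cancel₀ hρ.ne', one_smul,
      sub_sub_cancel]
  have e1 : ∑ i, inner ℝ (lam (k + 2) i - lam' i) (z (k + 2) i - y' i) = 0 := by
    have a1 := h.orth (k + 1) _ (L.sub_mem (h.mem (k + 1)) hs.mem)
    have a2 := hs.orth _ (L.sub_mem (h.mem (k + 1)) hs.mem)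
    rw [← sub_eq_zero.2 (a1.trans a2.symm), ← Finset.sum_sub_distrib]
    refine Finset.sum_congr rfl fun i _ => ?_
    rw [← inner_sub_left, sub_sub_sub_cancel_right]; rfl
  -- This needs `z (k + 1) ∈ L` and orthogonality at `k + 1`, which can fail for the initial state;
  -- hence the estimate starts at index 1.
  have e2 : ∑ i, inner ℝ (lam (k + 2) i - lam (k + 1) i) (z (k + 2) i - z (k + 1) i) = 0 := by
    have a1 := h.orth (k + 1) _ (L.sub_mem (h.mem (k + 1)) (h.mem k))
    have a2 := h.orth k _ (L.sub_mem (h.mem (k + 1)) (h.mem k))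
    rw [← sub_eq_zero.2 (a1.trans a2.symm), ← Finset.sum_sub_distrib]
    refine Finset.sum_congr rfl fun i _ => ?_
    rw [← inner_sub_left, sub_sub_sub_cancel_right]; rfl
  have key : ∀ i, ‖lam (k + 2) i - lam' i‖ ^ 2 / ρ + ρ * ‖z (k + 2) i - y' i‖ ^ 2 +
      (‖lam (k + 2) i - lam (k + 1) i‖ ^ 2 / ρ + ρ * ‖z (k + 2) i - z (k + 1) i‖ ^ 2) ≤
      ‖lam (k + 1) i - lam' i‖ ^ 2 / ρ + ρ * ‖z (k + 1) i - y' i‖ ^ 2 +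
      2 * inner ℝ (lam (k + 2) i - lam' i) (z (k + 2) i - y' i) +
      2 * inner ℝ (lam (k + 2) i - lam (k + 1) i) (z (k + 2) i - z (k + 1) i) := by
    intro i
    have a1 := h.le_of_mem_closure (k + 1) i (hs.mem_closure i)
    have a2 := hs.le i _ (h.mem_epigraph (k + 1) i)
    have a3 : lam (k + 1) i + ρ • (z (k + 1) i - y (k + 2) i)
        = lam (k + 2) i - ρ • (z (k + 2) i - z (k + 1) i) := by
      rw [h.update (k + 1) i]; module
    simp only [show k + 1 + 1 = k + 2 from rfl] at a1 a2
    rw [a3] at a1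
    have a4 : 0 ≤ inner ℝ (lam (k + 2) i - lam' i - ρ • (z (k + 2) i - z (k + 1) i))
        (y (k + 2) i - y' i) := by
      have : inner ℝ (lam (k + 2) i - lam' i - ρ • (z (k + 2) i - z (k + 1) i))
        (y (k + 2) i - y' i) = - inner ℝ (lam (k + 2) i - ρ • (z (k + 2) i - z (k + 1) i))
          (y' i - y (k + 2) i) - inner ℝ (lam' i) (y (k + 2) i - y' i) := by
        simp only [inner_sub_left, inner_sub_right]; ring
      rw [this]; linarith
    rw [hy i] at a4
    set l := lam (k + 2) i - lam' i with hl
    set d := lam (k + 2) i - lam (k + 1) i with hd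
    set w := z (k + 2) i - y' i with hw
    set f := z (k + 2) i - z (k + 1) i with hf
    have b1 : lam (k + 1) i - lam' i = l - d := by rw [hl, hd]; abel
    have b2 : z (k + 1) i - y' i = w - f := by rw [hw, hf]; abel
    have b3 : z (k + 2) i - ρ⁻¹ • d - y' i = w - ρ⁻¹ • d := by rw [hw]; abel
    rw [b3] at a4
    rw [b1, b2, norm_sub_sq_real l d, norm_sub_sq_real w f]
    have b4 : inner ℝ (l - ρ • f) (w - ρ⁻¹ • d) =
        inner ℝ l w - inner ℝ l d / ρ - ρ * inner ℝ w f + inner ℝ d f := by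
      simp only [inner_sub_left, inner_sub_right, real_inner_smul_left, real_inner_smul_right]
      rw [real_inner_comm f w, real_inner_comm f d]
      field_simp
      ring
    rw [b4] at a4
    have b5 : (‖l‖ ^ 2 - 2 * inner ℝ l d + ‖d‖ ^ 2) / ρ =
      ‖l‖ ^ 2 / ρ - 2 * (inner ℝ l d / ρ) + ‖d‖ ^ 2 / ρ := by ring
    rw [b5]
    nlinarith
  have := Finset.sum_le_sum fun i (_ : i ∈ Finset.univ) => key i
  simp only [Finset.sum_add_distrib, ← Finset.mul_sum, e1, e2] at this
  simp only [admmPotential, Finset.sum_add_distrib, ← Finset.mul_sum]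
  linarith

theorem antitone_admmPotential (h : IsADMMRun E L q ρ y z lam t) (hρ : 0 < ρ)
    {y' lam' : ι → X} {t' : ι → ℝ} (hs : IsEpigraphSaddle E L q y' t' lam') :
    Antitone fun k => admmPotential ρ (z (k + 1)) (lam (k + 1)) y' lam' :=
  antitone_nat_of_succ_le fun k => by
    have := h.admmPotential_add_le hρ hs k
    have := admmPotential_nonneg hρ (z (k + 2)) (lam (k + 2)) (z (k + 1)) (lam (k + 1))
    linarith

theorem tendsto_admmPotential_succ (h : IsADMMRun E L q ρ y z lam t) (hρ : 0 < ρ)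
    {y' lam' : ι → X} {t' : ι → ℝ} (hs : IsEpigraphSaddle E L q y' t' lam') :
    Tendsto (fun k => admmPotential ρ (z (k + 2)) (lam (k + 2)) (z (k + 1)) (lam (k + 1)))
      atTop (𝓝 0) := by
  obtain ⟨c, hc⟩ : ∃ c, Tendsto
      (fun k => admmPotential ρ (z (k + 1)) (lam (k + 1)) y' lam') atTop (𝓝 c) :=
    ⟨_, tendsto_atTop_ciInf (h.antitone_admmPotential hρ hs)
      ⟨0, by rintro _ ⟨k, rfl⟩; exact admmPotential_nonneg hρ _ _ _ _⟩⟩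
  have hc' := hc.comp (tendsto_add_atTop_nat 1)
  refine squeeze_zero (fun k => admmPotential_nonneg hρ _ _ _ _) (fun k => ?_)
    (by simpa using hc.sub hc')
  have := h.admmPotential_add_le hρ hs k
  change _ ≤ _ - admmPotential ρ (z (k + 2)) (lam (k + 2)) y' lam'
  linarith

/-- The proposed and the demanded quantities become equal. -/
theorem tendsto_sub (h : IsADMMRun E L q ρ y z lam t) (hρ : 0 < ρ)
    {y' lam' : ι → X} {t' : ι → ℝ} (hs : IsEpigraphSaddle E L q y' t' lam') (i : ι) :
    Tendsto (fun k => z (k + 2) i - y (k + 2) i) atTop (𝓝 0) := by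
  have h1 := (tendsto_of_admmPotential hρ (h.tendsto_admmPotential_succ hρ hs) i).1
  have h2 := h1.const_smul ρ⁻¹
  rw [smul_zero] at h2
  refine h2.congr fun k => ?_
  rw [h.update (k + 1) i, add_sub_cancel_left, smul_smul, inv_mul_cancel₀ hρ.ne', one_smul]

/-- The slope from the building step is `lam (k + 2) - ρ • (z (k + 2) - z (k + 1))`, and the
increment of `z` vanishes. -/
theorem tendsto_gradient (h : IsADMMRun E L q ρ y z lam t) (hρ : 0 < ρ)
    {y' lam' : ι → X} {t' : ι → ℝ} (hs : IsEpigraphSaddle E L q y' t' lam')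
    {ns : ℕ → ℕ} (hns : Tendsto ns atTop atTop) {i : ι} {l : X}
    (hl : Tendsto (fun n => lam (ns n + 2) i) atTop (𝓝 l)) :
    Tendsto (fun n => lam (ns n + 1) i + ρ • (z (ns n + 1) i - y (ns n + 2) i)) atTop (𝓝 l) := by
  have h1 := ((tendsto_of_admmPotential hρ (h.tendsto_admmPotential_succ hρ hs) i).2.comp
    hns).const_smul ρ
  rw [smul_zero] at h1
  have h2 := hl.sub h1
  rw [sub_zero] at h2
  refine h2.congr fun n => ?_
  rw [h.update (ns n + 1) i]
  simp only [Function.comp]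
  module

variable [FiniteDimensional ℝ X]

theorem exists_subseq_tendsto (h : IsADMMRun E L q ρ y z lam t) (hρ : 0 < ρ)
    {y' lam' : ι → X} {t' : ι → ℝ} (hs : IsEpigraphSaddle E L q y' t' lam') :
    ∃ (ns : ℕ → ℕ) (w l : ι → X), Tendsto ns atTop atTop ∧
      Tendsto (fun n => z (ns n + 2)) atTop (𝓝 w) ∧
      Tendsto (fun n => lam (ns n + 2)) atTop (𝓝 l) := by
  set c := admmPotential ρ (z 1) (lam 1) y' lam'
  have hc : ∀ k, admmPotential ρ (z (k + 2)) (lam (k + 2)) y' lam' ≤ c := fun k =>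
    h.antitone_admmPotential hρ hs (Nat.zero_le (k + 1))
  have hK : IsCompact ((Set.univ.pi fun i => Metric.closedBall (y' i) √(c / ρ)) ×ˢ
      (Set.univ.pi fun i => Metric.closedBall (lam' i) √(ρ * c))) :=
    (isCompact_univ_pi fun i => isCompact_closedBall _ _).prod
      (isCompact_univ_pi fun i => isCompact_closedBall _ _)
  obtain ⟨⟨w, l⟩, -, ns, hns, hlim⟩ := hK.tendsto_subseq
    (x := fun k => (z (k + 2), lam (k + 2))) fun k => by
      refine ⟨fun i _ => ?_, fun i _ => ?_⟩ <;> rw [mem_closedBall_iff_norm] <;>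
        refine Real.le_sqrt_of_sq_le ?_
      · exact (norm_sub_le_of_admmPotential_le hρ (hc k) i).2
      · exact (norm_sub_le_of_admmPotential_le hρ (hc k) i).1
  exact ⟨ns, w, l, hns.tendsto_atTop, (continuous_fst.tendsto _).comp hlim,
    (continuous_snd.tendsto _).comp hlim⟩

theorem exists_subseq_tendsto_saddle (h : IsADMMRun E L q ρ y z lam t) (hρ : 0 < ρ)
    {y' lam' : ι → X} {t' : ι → ℝ} (hs : IsEpigraphSaddle E L q y' t' lam') :
    ∃ (ns : ℕ → ℕ) (w l : ι → X) (τ : ι → ℝ), IsEpigraphSaddle E L q w τ l ∧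
      Tendsto ns atTop atTop ∧ Tendsto (fun n => z (ns n + 2)) atTop (𝓝 w) ∧
      Tendsto (fun n => lam (ns n + 2)) atTop (𝓝 l) := by
  obtain ⟨ns, w, l, hns, hw, hl⟩ := h.exists_subseq_tendsto hρ hs
  have hwi := tendsto_pi_nhds.1 hw
  have hli := tendsto_pi_nhds.1 hl
  have hyi : ∀ i, Tendsto (fun n => y (ns n + 2) i) atTop (𝓝 (w i)) := fun i => by
    simpa using (hwi i).sub ((h.tendsto_sub hρ hs i).comp hns)
  have hgi := fun i => h.tendsto_gradient hρ hs hns (hli i)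
  have hlow : ∀ i, Tendsto (fun n => t' i + inner ℝ (lam' i) (y (ns n + 2) i - y' i)) atTop
      (𝓝 (t' i + inner ℝ (lam' i) (w i - y' i))) := fun i =>
    (tendsto_const_nhds.inner ((hyi i).sub_const _)).const_add _
  have hupp : ∀ i (r : X × ℝ), Tendsto (fun n => r.2 -
      inner ℝ (lam (ns n + 1) i + ρ • (z (ns n + 1) i - y (ns n + 2) i)) (r.1 - y (ns n + 2) i))
      atTop (𝓝 (r.2 - inner ℝ (l i) (r.1 - w i))) := fun i r =>
    ((hgi i).inner ((hyi i).const_sub _)).const_sub _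
  have hlow' : ∀ i n, t' i + inner ℝ (lam' i) (y (ns n + 2) i - y' i) ≤ t (ns n + 2) i :=
    fun i n => hs.le i _ (h.mem_epigraph (ns n + 1) i)
  have hupp' : ∀ i, ∀ r ∈ closure (E i), ∀ n, t (ns n + 2) i ≤ r.2 -
      inner ℝ (lam (ns n + 1) i + ρ • (z (ns n + 1) i - y (ns n + 2) i)) (r.1 - y (ns n + 2) i) :=
    fun i r hr n => by
      have := h.le_of_mem_closure (ns n + 1) i hr
      simp only [show ns n + 1 + 1 = ns n + 2 from rfl] at this
      linarith
  -- The saddle point given in advance bounds the costs on both sides, so a further subsequence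
  -- makes them converge.
  choose B hB using fun i => (hupp i (y' i, t' i)).bddAbove_range
  choose A hA using fun i => (hlow i).bddBelow_range
  have hK : IsCompact (Set.univ.pi fun i => Set.Icc (A i) (B i)) :=
    isCompact_univ_pi fun i => isCompact_Icc
  obtain ⟨τ, -, ms, hms, hτ⟩ := hK.tendsto_subseq (x := fun n => t (ns n + 2)) fun n i _ =>
    ⟨(hA i ⟨n, rfl⟩).trans (hlow' i n),
      (hupp' i _ (hs.mem_closure i) n).trans (hB i ⟨n, rfl⟩)⟩
  have hτi := tendsto_pi_nhds.1 hτ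
  have hms := hms.tendsto_atTop
  refine ⟨ns, w, l, τ, ⟨?_, fun v hv => ?_, fun i => ?_, fun i r hr => ?_⟩, hns, hw, hl⟩
  · exact L.closed_of_finiteDimensional.mem_of_tendsto hw
      (Eventually.of_forall fun n => h.mem (ns n + 1))
  · have h1 : Tendsto (fun n => ∑ i, inner ℝ (lam (ns n + 2) i - q i) (v i)) atTop
        (𝓝 (∑ i, inner ℝ (l i - q i) (v i))) :=
      tendsto_finsetSum _ fun i _ => ((hli i).sub_const _).inner tendsto_const_nhds
    refine tendsto_nhds_unique h1 (tendsto_const_nhds.congr fun n => ?_)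
    exact (h.orth (ns n + 1) v hv).symm
  · exact mem_closure_of_tendsto (((hyi i).comp hms).prodMk_nhds (hτi i))
      (Eventually.of_forall fun n => h.mem_epigraph (ns (ms n) + 1) i)
  · have := le_of_tendsto_of_tendsto (hτi i) ((hupp i r).comp hms)
      (Eventually.of_forall fun n => hupp' i r (subset_closure hr) (ms n))
    linarith

/-- Convergence of the alternating direction method of multipliers. -/
theorem exists_tendsto (h : IsADMMRun E L q ρ y z lam t) (hρ : 0 < ρ)
    {y' lam' : ι → X} {t' : ι → ℝ} (hs : IsEpigraphSaddle E L q y' t' lam') :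
    ∃ (w l : ι → X) (τ : ι → ℝ), IsEpigraphSaddle E L q w τ l ∧
      (∀ i, Tendsto (fun k => y k i) atTop (𝓝 (w i))) ∧
      (∀ i, Tendsto (fun k => z k i) atTop (𝓝 (w i))) ∧
      (∀ i, Tendsto (fun k => lam k i) atTop (𝓝 (l i))) ∧
      (∀ i, Tendsto (fun k => t k i) atTop (𝓝 (τ i))) := by
  obtain ⟨ns, w, l, τ, hs', hns, hw, hl⟩ := h.exists_subseq_tendsto_saddle hρ hs
  have hwi := tendsto_pi_nhds.1 hw
  have hli := tendsto_pi_nhds.1 hl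
  have hsub : Tendsto (fun n => admmPotential ρ (z (ns n + 2)) (lam (ns n + 2)) w l) atTop
      (𝓝 0) := by
    have : Tendsto (fun n => admmPotential ρ (z (ns n + 2)) (lam (ns n + 2)) w l) atTop
        (𝓝 (∑ i, (‖l i - l i‖ ^ 2 / ρ + ρ * ‖w i - w i‖ ^ 2))) :=
      tendsto_finsetSum _ fun i _ => ((((hli i).sub_const _).norm.pow 2).div_const _).add
        ((((hwi i).sub_const _).norm.pow 2).const_mul _)
    simpa using this
  -- The cluster point is itself a saddle point, so the potential relative to it is antitone.
  have hpot : Tendsto (fun k => admmPotential ρ (z (k + 2)) (lam (k + 2)) w l) atTop (𝓝 0) := by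
    refine (tendsto_iff_tendsto_subseq_of_antitone (fun a b hab => ?_) hns).2 hsub
    exact h.antitone_admmPotential hρ hs' (Nat.succ_le_succ hab)
  have hz : ∀ i, Tendsto (fun k => z (k + 2) i) atTop (𝓝 (w i)) := fun i => by
    simpa using (tendsto_of_admmPotential (z' := fun _ => w) (lam' := fun _ => l) hρ
      hpot i).2.add_const (w i)
  have hlam : ∀ i, Tendsto (fun k => lam (k + 2) i) atTop (𝓝 (l i)) := fun i => by
    simpa using (tendsto_of_admmPotential (z' := fun _ => w) (lam' := fun _ => l) hρ
      hpot i).1.add_const (l i)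
  have hy : ∀ i, Tendsto (fun k => y (k + 2) i) atTop (𝓝 (w i)) := fun i => by
    simpa using (hz i).sub (h.tendsto_sub hρ hs i)
  have ht : ∀ i, Tendsto (fun k => t (k + 2) i) atTop (𝓝 (τ i)) := fun i => by
    have hlow : Tendsto (fun k => τ i + inner ℝ (l i) (y (k + 2) i - w i)) atTop
        (𝓝 (τ i + inner ℝ (l i) (w i - w i))) :=
      (tendsto_const_nhds.inner ((hy i).sub_const _)).const_add _
    have hupp : Tendsto (fun k => τ i - inner ℝ (lam (k + 1) i + ρ • (z (k + 1) i - y (k + 2) i))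
        (w i - y (k + 2) i)) atTop (𝓝 (τ i - inner ℝ (l i) (w i - w i))) :=
      ((h.tendsto_gradient hρ hs tendsto_id (hlam i)).inner ((hy i).const_sub _)).const_sub _
    rw [sub_self, inner_zero_right, add_zero] at hlow
    rw [sub_self, inner_zero_right, sub_zero] at hupp
    refine tendsto_of_tendsto_of_tendsto_of_le_of_le hlow hupp
      (fun k => hs'.le i _ (h.mem_epigraph (k + 1) i)) fun k => ?_
    have := h.le_of_mem_closure (k + 1) i (hs'.mem_closure i)
    simp only [show k + 1 + 1 = k + 2 from rfl] at this
    simp only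
    linarith
  exact ⟨w, l, τ, hs', fun i => (tendsto_add_atTop_iff_nat 2).1 (hy i),
    fun i => (tendsto_add_atTop_iff_nat 2).1 (hz i),
    fun i => (tendsto_add_atTop_iff_nat 2).1 (hlam i),
    fun i => (tendsto_add_atTop_iff_nat 2).1 (ht i)⟩

end IsADMMRun

end ADMM

/-! ### The bidding problem as an instance of ADMM -/

namespace Aggregation

variable {N M : ℕ} (P : Aggregation N M)

/-- The tuples of bids with a time-constant sum. -/
def balanced (N M : ℕ) : Submodule ℝ (Fin M → Bid N) where
  carrier := {w | IsTimeConstant (∑ b, w b)}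
  zero_mem' := by intro j k; simp
  add_mem' {v w} hv hw := by
    intro j k
    have h1 := hv j k
    have h2 := hw j k
    simp only [Pi.add_apply, Finset.sum_add_distrib, PiLp.add_apply, h1, h2]
  smul_mem' a w hw := by
    intro j k
    have h1 := hw j k
    simp only [Pi.smul_apply, ← Finset.smul_sum, PiLp.smul_apply, h1]

variable {P}

theorem mem_aggregationSet_iff {Y : Bid N} {z : Fin M → Bid N} :
    (Y, z) ∈ aggregationSet N M ↔ Y = ∑ b, z b ∧ z ∈ balanced N M := by
  refine and_congr_right fun h => ?_
  dsimp only at h ⊢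
  rw [h]; rfl

theorem cost_sum (u : P.Policies) (y : Fin M → Bid N) :
    P.cost u (∑ b, y b) = ∑ b, (inner ℝ (P.c b) (u b 0) - inner ℝ P.p (y b)) := by
  rw [cost, inner_sum, Finset.sum_sub_distrib]

/-- Proposed and demanded bids now occur in separate sums, so minimality can be tested in each
alone. -/
theorem lagrangian_eq {σ : P.State} (h : σ.Y = ∑ b, σ.ybar b) :
    P.lagrangian σ = ∑ b, (inner ℝ (P.c b) (σ.u b 0) - inner ℝ (σ.lam b) (σ.y b)) +
      ∑ b, inner ℝ (σ.lam b - P.p) (σ.ybar b) := by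
  rw [lagrangian, h, cost_sum, ← Finset.sum_add_distrib, ← Finset.sum_add_distrib]
  refine Finset.sum_congr rfl fun b _ => ?_
  simp only [inner_sub_left, inner_sub_right]
  ring

theorem mem_costEpigraph {b : Fin M} {u : Policy N (P.m b)} {y : Bid N} (h : (u, y) ∈ P.C b) :
    (y, inner ℝ (P.c b) (u 0)) ∈ P.costEpigraph b :=
  ⟨u, h, le_rfl⟩

/-! ### Saddle points -/

/-- Moving the multipliers along the residual would raise the Lagrangian by its squared norm. -/
theorem IsSaddlePoint.ybar_eq {σ : P.State} (h : P.IsSaddlePoint σ) : σ.ybar = σ.y := by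
  have h1 := h.2.1 fun b => σ.lam b + (σ.ybar b - σ.y b)
  simp only [lagrangian, inner_add_left, Finset.sum_add_distrib, real_inner_self_eq_norm_sq] at h1
  have h2 : ∑ b, ‖σ.ybar b - σ.y b‖ ^ 2 = 0 :=
    le_antisymm (by linarith) (Finset.sum_nonneg fun _ _ => by positivity)
  rw [Finset.sum_eq_zero_iff_of_nonneg fun _ _ => by positivity] at h2
  funext b
  simpa [sub_eq_zero] using h2 b (Finset.mem_univ b)

/-- The Lagrangian is affine in the demanded bids; minimality on a subspace forces its slope to
vanish there. -/
theorem IsSaddlePoint.orth {σ : P.State} (h : P.IsSaddlePoint σ) {w : Fin M → Bid N}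
    (hw : w ∈ balanced N M) : ∑ b, inner ℝ (σ.lam b - P.p) (w b) = 0 := by
  have hadm := mem_aggregationSet_iff.1 h.1.2
  have key : ∀ v ∈ balanced N M, 0 ≤ ∑ b, inner ℝ (σ.lam b - P.p) (v b) := by
    intro v hv
    have h1 := h.2.2 { σ with Y := ∑ b, (σ.ybar + v) b, ybar := σ.ybar + v }
      ⟨h.1.1, mem_aggregationSet_iff.2 ⟨rfl, Submodule.add_mem _ hadm.2 hv⟩⟩ rfl
    rw [lagrangian_eq hadm.1, lagrangian_eq rfl] at h1
    simp only [Pi.add_apply, inner_add_right, Finset.sum_add_distrib] at h1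
    linarith
  have h2 := key _ (Submodule.neg_mem _ hw)
  simp only [Pi.neg_apply, inner_neg_right, Finset.sum_neg_distrib] at h2
  linarith [key w hw]

theorem IsSaddlePoint.isEpigraphSaddle {σ : P.State} (h : P.IsSaddlePoint σ) :
    IsEpigraphSaddle P.costEpigraph (balanced N M) (fun _ => P.p) σ.y
      (fun b => inner ℝ (P.c b) (σ.u b 0)) σ.lam := by
  have hadm := mem_aggregationSet_iff.1 h.1.2
  refine ⟨h.ybar_eq ▸ hadm.2, fun w hw => h.orth hw,
    fun b => subset_closure (mem_costEpigraph (h.1.1 b)), ?_⟩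
  rintro b ⟨v, s⟩ ⟨u, hu, hus⟩
  have h1 := le_of_sum_le_sum_of_mem (A := P.C)
    (f := fun b x => inner ℝ (P.c b) (x.1 0) - inner ℝ (σ.lam b) x.2)
    (x := fun b => (σ.u b, σ.y b)) h.1.1 (fun x hx => by
      have h2 := h.2.2 { σ with u := fun b => (x b).1, y := fun b => (x b).2 } ⟨hx, h.1.2⟩ rfl
      rw [lagrangian_eq hadm.1, lagrangian_eq (by exact hadm.1)] at h2
      simpa using h2) b hu
  simp only [inner_sub_right] at h1 hus ⊢
  linarith

section Limit

variable {y lam : Fin M → Bid N} {t : Fin M → ℝ}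

theorem sum_le_cost
    (h : IsEpigraphSaddle P.costEpigraph (balanced N M) (fun _ => P.p) y t lam)
    {Y' : Bid N} {u' : P.Policies} {y' : Fin M → Bid N} (hf : P.IsFeasible Y' u' y') :
    ∑ b, (t b - inner ℝ P.p (y b)) ≤ P.cost u' Y' := by
  have hw := mem_aggregationSet_iff.1 (show (Y', y') ∈ aggregationSet N M from hf.2)
  rw [hf.2.1, cost_sum]
  exact h.sum_le hw.2 fun b => subset_closure (mem_costEpigraph (hf.1 b))

theorem IsSaddlePoint.isFeasible {σ : P.State} (h : P.IsSaddlePoint σ) :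
    P.IsFeasible σ.Y σ.u σ.y :=
  ⟨h.1.1, h.ybar_eq ▸ h.1.2⟩

theorem IsSaddlePoint.isOptimal {σ : P.State} (h : P.IsSaddlePoint σ) :
    P.IsOptimal σ.Y σ.u σ.y := by
  refine ⟨h.isFeasible, fun Y' u' y' hf => ?_⟩
  have := sum_le_cost h.isEpigraphSaddle hf
  rwa [← cost_sum, ← h.isFeasible.2.1] at this

/-- The limit costs may be realized by no policy; comparison with the given saddle point, which is
feasible, still identifies the value. -/
theorem IsOptimal.cost_eq {Y' : Bid N} {u' : P.Policies} {y' : Fin M → Bid N}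
    (ho : P.IsOptimal Y' u' y') {σ : P.State} (hσ : P.IsSaddlePoint σ)
    (h : IsEpigraphSaddle P.costEpigraph (balanced N M) (fun _ => P.p) y t lam) :
    P.cost u' Y' = ∑ b, (t b - inner ℝ P.p (y b)) := by
  refine le_antisymm ((ho.2 _ _ _ hσ.isFeasible).trans ?_) (sum_le_cost h ho.1)
  rw [hσ.isFeasible.2.1, cost_sum]
  exact hσ.isEpigraphSaddle.sum_le h.mem h.mem_closure

theorem isOptimal_of_le
    (h : IsEpigraphSaddle P.costEpigraph (balanced N M) (fun _ => P.p) y t lam)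
    {u : P.Policies} (hu : ∀ b, (u b, y b) ∈ P.C b ∧ inner ℝ (P.c b) (u b 0) ≤ t b) :
    P.IsOptimal (∑ b, y b) u y := by
  refine ⟨⟨fun b => (hu b).1, rfl, h.mem⟩, fun Y' u' y' hf => le_trans ?_ (sum_le_cost h hf)⟩
  rw [cost_sum]
  exact Finset.sum_le_sum fun b _ => sub_le_sub_right (hu b).2 _

/-- `lam` bounds the Lagrangian below by the optimal value, whichever optimal solution attains it;
`y'` need not equal `y`. -/
theorem IsOptimal.isSaddlePoint {Y' : Bid N} {u' : P.Policies} {y' : Fin M → Bid N}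
    (ho : P.IsOptimal Y' u' y') {σ : P.State} (hσ : P.IsSaddlePoint σ)
    (h : IsEpigraphSaddle P.costEpigraph (balanced N M) (fun _ => P.p) y t lam) :
    P.IsSaddlePoint { u := u', y := y', Y := Y', ybar := y', lam := lam } := by
  refine ⟨ho.1, fun lam' => by simp [lagrangian], fun σ' hσ' hlam => ?_⟩
  have hw := mem_aggregationSet_iff.1 hσ'.2
  have h1 := Finset.sum_le_sum fun b (_ : b ∈ Finset.univ) =>
    h.le b _ (mem_costEpigraph (hσ'.1 b))
  have h2 := h.orth _ hw.2
  have h3 := h.orth _ h.mem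
  have h4 : P.lagrangian { u := u', y := y', Y := Y', ybar := y', lam := lam } =
      P.cost u' Y' := by simp [lagrangian]
  rw [h4, ho.cost_eq hσ h, lagrangian_eq hw.1, hlam]
  simp only [inner_sub_left, inner_sub_right, Finset.sum_add_distrib,
    Finset.sum_sub_distrib] at h1 h2 h3 ⊢
  linarith

end Limit

/-! ### Steps -/

theorem buildingObjective_add_smul (ρ : ℝ) (b : Fin M) (lam ybar : Bid N)
    (x d : Policy N (P.m b) × Bid N) (ε : ℝ) :
    P.buildingObjective ρ b lam ybar (x + ε • d) = P.buildingObjective ρ b lam ybar x +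
      ε * (inner ℝ (P.c b) (d.1 0) - inner ℝ (lam + ρ • (ybar - x.2)) d.2) +
      ε ^ 2 * (ρ / 2 * ‖d.2‖ ^ 2) := by
  have h : ybar - (x + ε • d).2 = (ybar - x.2) - ε • d.2 := by
    simp only [Prod.snd_add, Prod.smul_snd]; abel
  rw [buildingObjective, buildingObjective, h, norm_sub_sq_real, norm_smul, mul_pow,
    Real.norm_eq_abs, sq_abs]
  simp only [Prod.fst_add, Prod.snd_add, Prod.smul_fst, Prod.smul_snd, Pi.add_apply,
    Pi.smul_apply, inner_add_left, inner_add_right, real_inner_smul_left, real_inner_smul_right]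
  ring

/-- Along the segment to a competitor, admissible by convexity, the objective is exactly quadratic;
its linear coefficient must be nonnegative. -/
theorem inner_le_of_isMinOn {ρ : ℝ} {b : Fin M} (hconv : Convex ℝ (P.C b)) {lam ybar : Bid N}
    {x : Policy N (P.m b) × Bid N} (hx : x ∈ P.C b)
    (hmin : IsMinOn (P.buildingObjective ρ b lam ybar) (P.C b) x)
    {r : Bid N × ℝ} (hr : r ∈ P.costEpigraph b) :
    inner ℝ (P.c b) (x.1 0) + inner ℝ (lam + ρ • (ybar - x.2)) (r.1 - x.2) ≤ r.2 := by
  obtain ⟨u, hu, hur⟩ := hr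
  have key : 0 ≤ inner ℝ (P.c b) (((u, r.1) - x).1 0) -
      inner ℝ (lam + ρ • (ybar - x.2)) ((u, r.1) - x).2 := by
    refine nonneg_of_forall_mul_add_sq_mul_nonneg
      (c := ρ / 2 * ‖((u, r.1) - x).2‖ ^ 2) fun ε h0 h1 => ?_
    have h2 := hmin (hconv.add_smul_sub_mem hx hu ⟨h0.le, h1⟩)
    rw [Set.mem_ofPred_eq, buildingObjective_add_smul] at h2
    linarith
  simp only [Prod.fst_sub, Prod.snd_sub, Pi.sub_apply, inner_sub_right (P.c b)] at key
  linarith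

theorem aggregationObjective_eq (ρ : ℝ) (lam y z w : Fin M → Bid N) :
    P.aggregationObjective ρ lam y (∑ b, w b, w) =
      P.aggregationObjective ρ lam y (∑ b, z b, z) +
      ∑ b, inner ℝ (lam b + ρ • (z b - y b) - P.p) (w b - z b) +
      ρ / 2 * ∑ b, ‖w b - z b‖ ^ 2 := by
  simp only [aggregationObjective, inner_sum]
  rw [← Finset.sum_sub_distrib, ← Finset.sum_sub_distrib, Finset.mul_sum,
    ← Finset.sum_add_distrib, ← Finset.sum_add_distrib]
  refine Finset.sum_congr rfl fun b _ => ?_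
  have h : w b - y b = (z b - y b) + (w b - z b) := by abel
  rw [h, norm_add_sq_real]
  simp only [inner_add_left, inner_sub_left, inner_sub_right, real_inner_smul_left]
  ring

theorem sum_inner_eq_zero_of_isMinOn {ρ : ℝ} {lam y z : Fin M → Bid N} {Y : Bid N}
    (hmem : (Y, z) ∈ aggregationSet N M)
    (hmin : IsMinOn (P.aggregationObjective ρ lam y) (aggregationSet N M) (Y, z))
    {w : Fin M → Bid N} (hw : w ∈ balanced N M) :
    ∑ b, inner ℝ (lam b + ρ • (z b - y b) - P.p) (w b) = 0 := by
  obtain ⟨rfl, hz⟩ := mem_aggregationSet_iff.1 hmem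
  have key : ∀ v ∈ balanced N M, 0 ≤ ∑ b, inner ℝ (lam b + ρ • (z b - y b) - P.p) (v b) := by
    intro v hv
    refine nonneg_of_forall_mul_add_sq_mul_nonneg (c := ρ / 2 * ∑ b, ‖v b‖ ^ 2) fun ε _ _ => ?_
    have h2 := hmin (mem_aggregationSet_iff.2
      ⟨rfl, add_mem hz (Submodule.smul_mem _ ε hv)⟩)
    rw [Set.mem_ofPred_eq, aggregationObjective_eq ρ lam y z (z + ε • v)] at h2
    simp only [Pi.add_apply, Pi.smul_apply, add_sub_cancel_left, real_inner_smul_right,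
      norm_smul, mul_pow, Real.norm_eq_abs, sq_abs, ← Finset.mul_sum] at h2
    linarith
  have h2 := key _ (Submodule.neg_mem _ hw)
  simp only [Pi.neg_apply, inner_neg_right, Finset.sum_neg_distrib] at h2
  linarith [key w hw]

theorem IsRun.isADMMRun (hconv : ∀ b, Convex ℝ (P.C b)) {ρ : ℝ} {it : ℕ → P.State}
    (h : P.IsRun ρ it) :
    IsADMMRun P.costEpigraph (balanced N M) (fun _ => P.p) ρ (fun k => (it k).y)
      (fun k => (it k).ybar) (fun k => (it k).lam)
      (fun k b => inner ℝ (P.c b) ((it k).u b 0)) where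
  mem_epigraph k b := mem_costEpigraph ((h k).1 b).1
  le k b _ hr := inner_le_of_isMinOn (hconv b) ((h k).1 b).1 ((h k).1 b).2 hr
  mem k := (mem_aggregationSet_iff.1 (h k).2.1.1).2
  orth k w hw := by
    -- The updated multiplier is exactly the gradient term of the aggregation step.
    simp only [(h k).2.2]
    exact sum_inner_eq_zero_of_isMinOn (h k).2.1.1 (h k).2.1.2 hw
  update k b := (h k).2.2 b

/-- Minimization takes place over the epigraph, where a saddle multiplier supplies the affine
minorant; a policy realizing the minimizer is then chosen. -/
theorem exists_isMinOn_buildingObjective {b : Fin M} (hne : (P.C b).Nonempty)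
    (hE : IsClosed (P.costEpigraph b)) {y lam' : Bid N} {t : ℝ}
    (hle : ∀ r ∈ P.costEpigraph b, t + inner ℝ lam' (r.1 - y) ≤ r.2) {ρ : ℝ} (hρ : 0 < ρ)
    (lam ybar : Bid N) :
    ∃ x ∈ P.C b, IsMinOn (P.buildingObjective ρ b lam ybar) (P.C b) x := by
  obtain ⟨⟨u₀, y₀⟩, h₀⟩ := hne
  obtain ⟨⟨v, s⟩, ⟨u, hu, hus⟩, hmin⟩ := exists_isMinOn_augmented hE
    ⟨_, mem_costEpigraph h₀⟩ (γ := t - inner ℝ lam' y) (lam' := lam') (fun r hr => by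
      have := hle r hr
      rw [inner_sub_right] at this
      linarith) hρ lam ybar
  refine ⟨(u, v), hu, fun x hx => ?_⟩
  have h1 := hmin (mem_costEpigraph (u := x.1) (y := x.2) hx)
  simp only [Set.mem_ofPred_eq, buildingObjective] at h1 hus ⊢
  linarith

theorem exists_isMinOn_aggregationObjective {ρ : ℝ} (hρ : 0 < ρ) (lam y : Fin M → Bid N) :
    ∃ w ∈ aggregationSet N M, IsMinOn (P.aggregationObjective ρ lam y) (aggregationSet N M) w := by
  -- Completing the square: the minimizer is the projection of this point onto `balanced`.
  obtain ⟨z, hz, horth⟩ := exists_mem_forall_sum_inner_sub_eq_zero (balanced N M)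
    fun b => y b - ρ⁻¹ • (lam b - P.p)
  refine ⟨(∑ b, z b, z), mem_aggregationSet_iff.2 ⟨rfl, hz⟩, ?_⟩
  rintro ⟨_, w⟩ hmem
  obtain ⟨rfl, hw⟩ := mem_aggregationSet_iff.1 hmem
  rw [Set.mem_ofPred_eq, aggregationObjective_eq ρ lam y z w]
  have h1 : ∑ b, inner ℝ (lam b + ρ • (z b - y b) - P.p) (w b - z b) = 0 := by
    rw [← mul_zero ρ, ← horth _ (sub_mem hw hz), Finset.mul_sum]
    refine Finset.sum_congr rfl fun b _ => ?_
    rw [← real_inner_smul_left, Pi.sub_apply]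
    congr 1
    rw [smul_sub ρ (z b) (y b - _), smul_sub ρ (y b), smul_smul, mul_inv_cancel₀ hρ.ne', one_smul]
    module
  have h2 : 0 ≤ ρ / 2 * ∑ b, ‖w b - z b‖ ^ 2 := by positivity
  linarith

theorem exists_isStep (hne : ∀ b, (P.C b).Nonempty) (hE : ∀ b, IsClosed (P.costEpigraph b))
    {σ' : P.State} (hσ' : P.IsSaddlePoint σ') {ρ : ℝ} (hρ : 0 < ρ) (σ : P.State) :
    ∃ τ, P.IsStep ρ σ τ := by
  choose x hx hmin using fun b => exists_isMinOn_buildingObjective (hne b) (hE b)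
    (hσ'.isEpigraphSaddle.le b) hρ (σ.lam b) (σ.ybar b)
  obtain ⟨w, hw, hwmin⟩ := exists_isMinOn_aggregationObjective (P := P) hρ σ.lam fun b => (x b).2
  exact ⟨⟨fun b => (x b).1, fun b => (x b).2, w.1, w.2,
    fun b => σ.lam b + ρ • (w.2 b - (x b).2)⟩, fun b => ⟨hx b, hmin b⟩, ⟨hw, hwmin⟩, fun _ => rfl⟩

theorem exists_isRun (hne : ∀ b, (P.C b).Nonempty) (hE : ∀ b, IsClosed (P.costEpigraph b))
    {σ' : P.State} (hσ' : P.IsSaddlePoint σ') {ρ : ℝ} (hρ : 0 < ρ)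
    (ybar₀ lam₀ : Fin M → Bid N) :
    ∃ it : ℕ → P.State, P.IsRun ρ it ∧ (it 0).ybar = ybar₀ ∧ (it 0).lam = lam₀ := by
  choose next hnext using exists_isStep hne hE hσ' hρ
  exact ⟨fun k => next^[k] ⟨0, 0, 0, ybar₀, lam₀⟩, fun k => by
    simp only [Function.iterate_succ_apply']; exact hnext _, rfl, rfl⟩

/-! ### Policies -/

/-- The policy space need not be first countable, so an ultrafilter replaces a subsequence. -/
theorem mem_and_le_of_mapClusterPt {b : Fin M} (hclosed : IsClosed (P.C b))
    {u : ℕ → Policy N (P.m b)} {y : ℕ → Bid N} {v : Bid N} {t : ℝ}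
    (hmem : ∀ k, (u k, y k) ∈ P.C b) (hy : Tendsto y atTop (𝓝 v))
    (ht : Tendsto (fun k => inner ℝ (P.c b) (u k 0)) atTop (𝓝 t))
    {a : Policy N (P.m b)} (ha : MapClusterPt a atTop u) :
    (a, v) ∈ P.C b ∧ inner ℝ (P.c b) (a 0) ≤ t := by
  obtain ⟨l, hl, hla⟩ := mapClusterPt_iff_ultrafilter.1 ha
  refine ⟨hclosed.mem_of_tendsto (hla.prodMk_nhds (hy.mono_left hl)) (Eventually.of_forall hmem),
    (tendsto_nhds_unique ?_ (ht.mono_left hl)).le⟩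
  exact tendsto_const_nhds.inner (((continuous_apply 0).tendsto a).comp hla)

theorem exists_seq_tendsto_sub_zero {b : Fin M}
    (hfin : FiniteDimensional ℝ (Submodule.span ℝ (P.C b))) {S : Set (Policy N (P.m b))}
    {u : ℕ → Policy N (P.m b)} {y : ℕ → Bid N} (hmem : ∀ k, (u k, y k) ∈ P.C b)
    (hbdd : ∀ s, Bornology.IsBounded (Set.range fun k => u k s))
    (hS : ∀ a, MapClusterPt a atTop u → a ∈ S) :
    ∃ s : ℕ → Policy N (P.m b), (∀ k, s k ∈ S) ∧ Tendsto (fun k => u k - s k) atTop (𝓝 0) := by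
  have hK : IsCompact (Set.univ.pi fun s => closure (Set.range fun k => u k s)) :=
    isCompact_univ_pi fun s => (hbdd s).isCompact_closure
  refine exists_seq_mem_tendsto_sub_zero
    ((Submodule.span ℝ (P.C b)).map (LinearMap.fst ℝ (Policy N (P.m b)) (Bid N))) hK
    (fun k => ⟨_, Submodule.subset_span (hmem k), rfl⟩)
    (fun k s _ => subset_closure ⟨k, rfl⟩) hS

end Aggregation

theorem proposition1 {N M : ℕ} (P : Aggregation N M)
    (hne : ∀ b, (P.C b).Nonempty)
    (hfin : ∀ b, FiniteDimensional ℝ (Submodule.span ℝ (P.C b)))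
    (hconv : ∀ b, Convex ℝ (P.C b))
    (hclosed : ∀ b, IsClosed (P.C b))
    (hsaddle : ∃ σ : P.State, P.IsSaddlePoint σ)
    (ρ : ℝ) (hρ : 0 < ρ) :
    -- the algorithm can be carried out from every initialization
    ((∀ b, IsClosed (P.costEpigraph b)) →
      ∀ ybar₀ lam₀ : Fin M → Bid N,
        ∃ it : ℕ → P.State, P.IsRun ρ it ∧ (it 0).ybar = ybar₀ ∧ (it 0).lam = lam₀) ∧
    -- and every sequence that it generates converges
    ∀ it : ℕ → P.State, P.IsRun ρ it →
      ∃ (Y : Bid N) (y lam : Fin M → Bid N),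
        Tendsto (fun k => (it k).Y) atTop (𝓝 Y) ∧
        (∀ b, Tendsto (fun k => (it k).y b) atTop (𝓝 (y b))) ∧
        (∀ b, Tendsto (fun k => (it k).ybar b) atTop (𝓝 (y b))) ∧
        (∀ b, Tendsto (fun k => (it k).lam b) atTop (𝓝 (lam b))) ∧
        Y = ∑ b, y b ∧ IsTimeConstant Y ∧
        -- the objective converges to the optimal value, which is attained
        (∃ (Y' : Bid N) (u' : P.Policies) (y' : Fin M → Bid N), P.IsOptimal Y' u' y' ∧
          Tendsto (fun k => P.cost (it k).u (it k).Y) atTop (𝓝 (P.cost u' Y'))) ∧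
        -- the limit of the multipliers is an optimal multiplier
        (∀ (Y' : Bid N) (u' : P.Policies) (y' : Fin M → Bid N), P.IsOptimal Y' u' y' →
          P.IsSaddlePoint { u := u', y := y', Y := Y', ybar := y', lam := lam }) ∧
        -- every accumulation point of the iterates is an optimal solution
        (∀ u : P.Policies, MapClusterPt u atTop (fun k => (it k).u) → P.IsOptimal Y u y) ∧
        -- the limits of the bids are those of an optimal solution
        ((∀ b, IsClosed (P.costEpigraph b)) → ∃ u : P.Policies, P.IsOptimal Y u y) ∧
        -- bounded iterates converge to the set of optimal solutions
        ((∀ b s, Bornology.IsBounded (Set.range fun k => (it k).u b s)) →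
          ∃ u : ℕ → P.Policies, (∀ k, P.IsOptimal Y (u k) y) ∧
            Tendsto (fun k => (it k).u - u k) atTop (𝓝 0)) := by
  obtain ⟨σ, hσ⟩ := hsaddle
  refine ⟨fun hE => Aggregation.exists_isRun hne hE hσ hρ, fun it hit => ?_⟩
  obtain ⟨y, lam, t, hs, hy, hybar, hlam, ht⟩ :=
    (hit.isADMMRun hconv).exists_tendsto hρ hσ.isEpigraphSaddle
  have hY : Tendsto (fun k => (it k).Y) atTop (𝓝 (∑ b, y b)) := by
    refine (tendsto_add_atTop_iff_nat 1).1 ?_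
    refine Tendsto.congr (fun k => ((hit k).2.1.1.1).symm) ?_
    exact tendsto_finsetSum _ fun b _ => (hybar b).comp (tendsto_add_atTop_nat 1)
  -- Shifted by one, since the initial state need not be admissible.
  have hcl : ∀ b (a : Policy N (P.m b)), MapClusterPt a atTop (fun k => (it (k + 1)).u b) →
      (a, y b) ∈ P.C b ∧ inner ℝ (P.c b) (a 0) ≤ t b := fun b a ha =>
    Aggregation.mem_and_le_of_mapClusterPt (hclosed b) (fun k => ((hit k).1 b).1)
      ((hy b).comp (tendsto_add_atTop_nat 1)) ((ht b).comp (tendsto_add_atTop_nat 1)) ha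
  refine ⟨∑ b, y b, y, lam, hY, hy, hybar, hlam, rfl, hs.mem,
    ⟨_, _, _, hσ.isOptimal, ?_⟩, fun Y' u' y' ho => ho.isSaddlePoint hσ hs, fun u hu => ?_,
    fun hE => ?_, fun hb => ?_⟩
  · rw [hσ.isOptimal.cost_eq hσ hs, Finset.sum_sub_distrib, ← inner_sum]
    exact (tendsto_finsetSum _ fun b _ => ht b).sub (tendsto_const_nhds.inner hY)
  · refine Aggregation.isOptimal_of_le hs fun b => hcl b (u b) ?_
    have h1 : MapClusterPt (u b) atTop (fun k => (it k).u b) :=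
      hu.continuousAt_comp (continuous_apply b).continuousAt
    rw [MapClusterPt, ← map_add_atTop_eq_nat 1, map_map] at h1
    exact h1
  · have h1 := fun b => (hE b).closure_eq ▸ hs.mem_closure b
    choose u hu using h1
    exact ⟨u, Aggregation.isOptimal_of_le hs hu⟩
  · choose s hs' hlim using fun b => Aggregation.exists_seq_tendsto_sub_zero (hfin b)
      (S := {a | (a, y b) ∈ P.C b ∧ inner ℝ (P.c b) (a 0) ≤ t b})
      (fun k => ((hit k).1 b).1)
      (fun v => (hb b v).subset (Set.range_comp_subset_range _ fun k => (it k).u b v)) (hcl b)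
    -- `s b k` approximates the policy of iterate `k + 1`; the value at `k = 0` is irrelevant to the
    -- limit.
    refine ⟨fun k b => s b (k - 1), fun k => Aggregation.isOptimal_of_le hs fun b => hs' b (k - 1),
      (tendsto_add_atTop_iff_nat 1).1 (tendsto_pi_nhds.2 fun b => ?_)⟩
    exact hlim b
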